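/- Let $m\ge 2$, write points of $\mathbb R^m=\mathbb R^{m-1}\times\mathbb R$ as $(x,t)$, put $\partial_t=(0,1)$, and let $h(x,t)=\mu(t)$ with $\mu\in C^1(\mathbb R)$. Let $P$ be a connected smooth manifold without boundary of dimension $n<m$, smoothly immersed in $\mathbb R^m$, with the induced Riemannian metric. Write $\overline H^h_P=n\overline H_P-(\nabla h)^\perp$ for its weighted mean curvature vector, where $n\overline H_P$ is the trace of the second fundamental form. $P$ is called $h$-minimal if $\overline H^h_P=0$. Assume that $P$ is $h$-parabolic, i.e. every $u\in C^2(P)$ that is bounded from above and satisfies $\Delta_Pu+\langle\nabla_Ph,\nabla_Pu\rangle\ge 0$ on $P$ is constant. For a unit vector $a$ and $s\in\mathbb R$ let $\mathcal L_s=\{p:\langle p,a\rangle=s\}$, $\mathcal L_s^-=\{p:\langle p,a\rangle\le s\}$ and $\mathcal L_s^+=\{p:\langle p,a\rangle\ge s\}$. Containments refer to the image of the immersion, and $P=\mathcal L_s$ means that the immersion is one-to-one with image $\mathcal L_s$. (i) Let $a=\partial_t$. Suppose that for some constant $c\ge 0$ we have $\mu'\ge c$ (resp. $\mu'\le -c$)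 on $\mathbb R$, $|\overline H^h_P|\le c$ on $P$, and $P\subset\mathcal L^-_{t_0}$ (resp. $P\subset\mathcal L^+_{t_0}$) for some $t_0\in\mathbb R$. Then there is $s\in\mathbb R$ with $P\subseteq\mathcal L_s$, $\mu'(s)=c$ (resp. $\mu'(s)=-c$), and $\overline H^h_P=-c\,\partial_t$ (resp. $\overline H^h_P=c\,\partial_t$) on $P$. Moreover, if $n=m-1$ and $P$ is complete, then $P=\mathcal L_s$ and $m\in\{2,3\}$. (ii) Let $a$ be a unit vector with $\langle a,\partial_t\rangle\in(0,1)$. Suppose that $\mu'\ge 0$ (resp. $\mu'\le 0$) on $\mathbb R$, that $P$ is $h$-minimal, and that $P\subset\mathcal L^-_{t_0}$ (resp. $P\subset\mathcal L^+_{t_0}$) for some $t_0\in\mathbb R$. Then there is $s\in\mathbb R$ with $P\subseteq\mathcal L_s$, and $\mu$ is constant on the vertical projection $\{t:(x,t)\in P\}$ of $P$. If moreover $n=m-1$ and $P$ is complete, then $P=\mathcal L_s$ and $\mu$ is constant on $\mathbb R$. (iii) Let $a$ be a unit vector with $\langle a,\partial_t\rangle=0$. If $P$ is $h$-minimal and $P\subset\mathcal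 L^-_{t_0}$ or $P\subset\mathcal L^+_{t_0}$ for some $t_0\in\mathbb R$, then $P\subseteq\mathcal L_s$ for some $s\in\mathbb R$. If moreover $n=m-1$ and $P$ is complete, then $P=\mathcal L_s$. -/

import Mathlib

open scoped Manifold ContDiff Topology RealInnerProductSpace

/-!
An immersed submanifold `P` of dimension `n` in a Euclidean space `E` is given by an abstract
`n`-manifold `P` together with a smooth immersion `F : P → E`; the Riemannian metric of `P` is the
one induced by `F`, that is `g_p(v, w) = ⟪dF_p v, dF_p w⟫`.
-/

namespace ImmersedSubmanifold

section Calculus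

variable {E : Type*} [NormedAddCommGroup E] [InnerProductSpace ℝ E]
  (n : ℕ) {P : Type*} [TopologicalSpace P] [ChartedSpace (EuclideanSpace ℝ (Fin n)) P]

/-- The differential at `p` of a map from `P` to a normed space `V`. The tangent space of `P` at
`p` is identified with `ℝⁿ` through the preferred chart at `p`, as always in Mathlib. -/
noncomputable def differential {V : Type*} [NormedAddCommGroup V] [NormedSpace ℝ V]
    (f : P → V) (p : P) : EuclideanSpace ℝ (Fin n) →L[ℝ] V :=
  mfderiv (𝓡 n) 𝓘(ℝ, V) f p

/-- `F` is a smooth immersion. -/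
structure IsSmoothImmersion (F : P → E) : Prop where
  contMDiff : ContMDiff (𝓡 n) 𝓘(ℝ, E) ∞ F
  injective_differential : ∀ p, Function.Injective (differential n F p)

/-- The tangent space of the submanifold at `p`, as a linear subspace of the ambient space. -/
noncomputable def tangentPlane (F : P → E) (p : P) : Submodule ℝ E :=
  LinearMap.range (differential n F p).toLinearMap

instance (F : P → E) (p : P) : FiniteDimensional ℝ (tangentPlane n F p) := by
  unfold tangentPlane; infer_instance

/-- The normal component `X^⊥` at `p` of an ambient vector `X`. -/
noncomputable def normalPart (F : P → E) (p : P) (X : E) : E :=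
  X - (tangentPlane n F p).starProjection X

/-- An orthonormal basis `e₁, e₂, …` of the tangent space of `P` at `p` for the induced metric:
the vectors `dF_p(e_i)` form an orthonormal basis of the tangent plane. -/
noncomputable def tangentFrame (F : P → E) (p : P)
    (i : Fin (Module.finrank ℝ (tangentPlane n F p))) : EuclideanSpace ℝ (Fin n) :=
  Classical.choose (LinearMap.mem_range.mp
    (show _ ∈ LinearMap.range (differential n F p).toLinearMap from
      (stdOrthonormalBasis ℝ (tangentPlane n F p) i).2))

theorem differential_tangentFrame (F : P → E) (p : P)
    (i : Fin (Module.finrank ℝ (tangentPlane n F p))) :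
    differential n F p (tangentFrame n F p i) = (stdOrthonormalBasis ℝ (tangentPlane n F p) i : E) :=
  Classical.choose_spec (LinearMap.mem_range.mp
    (show _ ∈ LinearMap.range (differential n F p).toLinearMap from
      (stdOrthonormalBasis ℝ (tangentPlane n F p) i).2))

/-- The gradient `∇_P u = ∑ᵢ du(e_i) e_i` for the induced metric, as a vector of the ambient space
tangent to the submanifold. -/
noncomputable def gradP (F : P → E) (u : P → ℝ) (p : P) : E :=
  ∑ i, differential n u p (tangentFrame n F p i) • differential n F p (tangentFrame n F p i)

/-- The divergence `div_P X = ∑ᵢ ⟪D_{e_i} X, e_i⟫` relative to the submanifold of an ambient vector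
field `X` along it. -/
noncomputable def divP (F : P → E) (X : P → E) (p : P) : ℝ :=
  ∑ i, ⟪differential n X p (tangentFrame n F p i), differential n F p (tangentFrame n F p i)⟫

/-- The Laplace operator `Δ_P u = div_P (∇_P u)` of the induced metric. -/
noncomputable def laplacianP (F : P → E) (u : P → ℝ) (p : P) : ℝ :=
  divP n F (gradP n F u) p

/-- The weighted Laplacian `Δ_P^h u = Δ_P u + ⟪∇_P h, ∇_P u⟫` for the restriction to the
submanifold of the ambient weight `e^h`. -/
noncomputable def weightedLaplacianP (F : P → E) (h : E → ℝ) (u : P → ℝ) (p : P) : ℝ :=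
  laplacianP n F u p + ⟪gradP n F (fun q => h (F q)) p, gradP n F u p⟫

/-- `h`-parabolicity: every `C²` function which is bounded from above and `h`-subharmonic
(`Δ_P^h u ≥ 0`) is constant. -/
def IsWeightedParabolic (F : P → E) (h : E → ℝ) : Prop :=
  ∀ u : P → ℝ, ContMDiff (𝓡 n) 𝓘(ℝ, ℝ) 2 u → BddAbove (Set.range u) →
    (∀ p, 0 ≤ weightedLaplacianP n F h u p) → ∃ k : ℝ, ∀ p, u p = k

/-- The second fundamental form `II_p(v, w) = (D_v D_w F)^⊥`, computed in the preferred chart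
at `p`. -/
noncomputable def secondFundamentalForm (F : P → E) (p : P)
    (v w : EuclideanSpace ℝ (Fin n)) : E :=
  normalPart n F p
    (fderiv ℝ (fderiv ℝ (F ∘ (extChartAt (𝓡 n) p).symm)) (extChartAt (𝓡 n) p p) v w)

/-- The (unnormalized) mean curvature vector `n H̄_P = ∑ᵢ II(e_i, e_i)`. For every local orthonormal
frame `N_j` of normal fields it equals `-∑ⱼ (div_P N_j) N_j`. -/
noncomputable def meanCurvatureVector (F : P → E) (p : P) : E :=
  ∑ i, secondFundamentalForm n F p (tangentFrame n F p i) (tangentFrame n F p i)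

/-- The weighted mean curvature vector `H̄_P^h = n H̄_P - (∇h)^⊥`. -/
noncomputable def weightedMeanCurvatureVector [CompleteSpace E] (F : P → E) (h : E → ℝ) (p : P) :
    E :=
  meanCurvatureVector n F p - normalPart n F p (gradient h (F p))

/-- `h`-minimal submanifolds: `H̄_P^h = 0` everywhere. -/
def IsWeightedMinimal [CompleteSpace E] (F : P → E) (h : E → ℝ) : Prop :=
  ∀ p, weightedMeanCurvatureVector n F h p = 0

/-- The Riemannian distance of the metric induced by `F` on `P`: the infimum of the lengths of the
`C¹` curves joining two points, the length of a tangent vector `v` at `p` being `‖dF_p v‖`. -/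
noncomputable def inducedEDist (F : P → E) (p q : P) : ENNReal :=
  letI : ∀ x : P, ENorm (TangentSpace (𝓡 n) x) := fun x => ⟨fun v => ‖differential n F x v‖ₑ⟩
  Manifold.riemannianEDist (𝓡 n) p q

/-- The induced metric on `P` is complete: every Cauchy sequence of the induced Riemannian distance
converges in `P`. -/
def IsCompleteSubmanifold (F : P → E) : Prop :=
  ∀ x : ℕ → P,
    (∀ ε : ENNReal, 0 < ε → ∃ N, ∀ i, N ≤ i → ∀ j, N ≤ j → inducedEDist n F (x i) (x j) < ε) →
    ∃ p, Filter.Tendsto x Filter.atTop (𝓝 p)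

/-- The submanifold is contained in the set `S`. -/
def ContainedIn (F : P → E) (S : Set E) : Prop := ∀ p, F p ∈ S

/-- The submanifold coincides with `S`: the immersion is one-to-one with image `S`. -/
def CoincidesWith (F : P → E) (S : Set E) : Prop :=
  Function.Injective F ∧ Set.range F = S

/-- The hyperplane `ℒ_t = {p ; ⟪p, a⟫ = t}` with unit normal `a`. -/
def hyperplane (a : E) (t : ℝ) : Set E := {p | ⟪p, a⟫ = t}

/-- The closed half-space `ℒ_t^- = {p ; ⟪p, a⟫ ≤ t}`. -/
def lowerHalfSpace (a : E) (t : ℝ) : Set E := {p | ⟪p, a⟫ ≤ t}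

/-- The closed half-space `ℒ_t^+ = {p ; ⟪p, a⟫ ≥ t}`. -/
def upperHalfSpace (a : E) (t : ℝ) : Set E := {p | t ≤ ⟪p, a⟫}

end Calculus

/-- The Euclidean space `ℝ^m = ℝ^{m-1} × ℝ`, with points `(x, t)`. -/
abbrev Ambient (m : ℕ) : Type := WithLp 2 (EuclideanSpace ℝ (Fin (m - 1)) × ℝ)

/-- The vertical coordinate `t` of a point `(x, t)`. -/
def height {m : ℕ} (p : Ambient m) : ℝ := p.snd

/-- The vertical unit vector `∂_t = (0, 1)`. -/
def verticalVector (m : ℕ) : Ambient m := WithLp.toLp 2 (0, 1)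

/-- The function `h(x, t) = μ(t)`. -/
def verticalWeight (m : ℕ) (μ : ℝ → ℝ) : Ambient m → ℝ := fun p => μ (height p)

end ImmersedSubmanifold

open ImmersedSubmanifold

/-! For a fixed vector `b`, the function `u = ⟪F, b⟫` has weighted Laplacian `⟪b, H^h + ∇h⟫`: its
Laplacian is `⟪b, nH⟫`, and `H^h + ∇h = nH + (∇h)^T`. Take `b = ±a`. The sign of `μ'` and the bound
on `H^h` make `u` subharmonic, the half-space bounds it above, and parabolicity makes it constant
(`IsWeightedParabolic.exists_inner_eq`). Its weighted Laplacian then vanishes, which forces equality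
in every estimate used: in (i) `|μ'| = c` at the height of `P` together with equality in
Cauchy–Schwarz, in (ii) `μ' = 0` at every height that `P` reaches.

A hypersurface inside a hyperplane is a local isometry into it. Completeness lets every segment be
lifted, so this map is a bijection (`bijective_of_isCompleteSubmanifold`).

For the restriction on `m` in (i), the equality case gives `H^h + ∇h = 0`. By
`weightedLaplacianP_comp_of_hasGradientAt` the weighted Laplacian of a restricted ambient function
is then the trace of its Hessian on the tangent plane. If `n ≥ 3`, the bounded function `-(1 +
|y|²)^{-1/2}` is subharmonic, so parabolicity would make `|F|` constant, which is impossible on a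
hyperplane. -/

namespace ImmersedSubmanifold

/-! ### Smooth dependence of orthogonal projections. -/

section RangeProjection

variable {V E : Type*} [NormedAddCommGroup V] [InnerProductSpace ℝ V] [FiniteDimensional ℝ V]
  [NormedAddCommGroup E] [InnerProductSpace ℝ E] [CompleteSpace E]

/-- The orthogonal projection onto the range of an injective linear map `L`, given by the formula
`L (L† L)⁻¹ L†`, which depends smoothly on `L`. -/
noncomputable def rangeProjection (L : V →L[ℝ] E) : E →L[ℝ] E :=
  have := FiniteDimensional.complete ℝ V
  L ∘L (Ring.inverse (ContinuousLinearMap.adjoint L ∘L L : V →L[ℝ] V)) ∘L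
    ContinuousLinearMap.adjoint L

theorem isUnit_adjoint_comp_self [CompleteSpace V] {L : V →L[ℝ] E} (hL : Function.Injective L) :
    IsUnit (ContinuousLinearMap.adjoint L ∘L L : V →L[ℝ] V) := by
  have hinj : Function.Injective (ContinuousLinearMap.adjoint L ∘L L : V →L[ℝ] V) := by
    rw [injective_iff_map_eq_zero]
    intro v hv
    have h : ⟪L v, L v⟫ = 0 := by
      rw [← ContinuousLinearMap.adjoint_inner_left]
      simp only [ContinuousLinearMap.comp_apply] at hv
      rw [hv, inner_zero_left]
    exact hL (by rw [inner_self_eq_zero.mp h, map_zero])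
  let e := LinearEquiv.ofInjectiveEndo
    (ContinuousLinearMap.adjoint L ∘L L : V →L[ℝ] V).toLinearMap hinj
  rw [ContinuousLinearMap.isUnit_iff_bijective]
  exact e.bijective

theorem starProjection_range_eq {L : V →L[ℝ] E} (hL : Function.Injective L)
    (K : Submodule ℝ E) [K.HasOrthogonalProjection] (hK : K = LinearMap.range L.toLinearMap)
    (x : E) : K.starProjection x = rangeProjection L x := by
  have := FiniteDimensional.complete ℝ V
  refine Submodule.eq_starProjection_of_mem_of_inner_eq_zero ?_ ?_
  · rw [hK]; exact ⟨_, rfl⟩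
  · rw [hK]
    rintro _ ⟨v, rfl⟩
    have h := Ring.mul_inverse_cancel _ (isUnit_adjoint_comp_self hL)
    have h' := congrArg (fun T : V →L[ℝ] V => T (ContinuousLinearMap.adjoint L x)) h
    change ContinuousLinearMap.adjoint L (rangeProjection L x) =
      ContinuousLinearMap.adjoint L x at h'
    change ⟪x - rangeProjection L x, L v⟫ = 0
    rw [← ContinuousLinearMap.adjoint_inner_left, map_sub, h', sub_self, inner_zero_left]

/-- Adjoint, composition and inversion at a unit are all differentiable. This is what allows the
tangential part of a field to be differentiated along the submanifold. -/
theorem differentiableAt_rangeProjection {L : V →L[ℝ] E} (hL : Function.Injective L) :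
    DifferentiableAt ℝ (rangeProjection (V := V) (E := E)) L := by
  have := FiniteDimensional.complete ℝ V
  have hadj : DifferentiableAt ℝ
      (fun L : V →L[ℝ] E => (ContinuousLinearMap.adjoint L : E →L[ℝ] V)) L := by
    exact ((ContinuousLinearMap.adjoint (𝕜 := ℝ) (E := V) (F := E)).toContinuousLinearEquiv :
      (V →L[ℝ] E) ≃L[ℝ] (E →L[ℝ] V)).differentiableAt
  have h2 : DifferentiableAt ℝ
      (fun L : V →L[ℝ] E => (ContinuousLinearMap.adjoint L ∘L L : V →L[ℝ] V)) L :=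
    hadj.clm_comp differentiableAt_id
  have h3 : DifferentiableAt ℝ (fun L : V →L[ℝ] E =>
      Ring.inverse (ContinuousLinearMap.adjoint L ∘L L : V →L[ℝ] V)) L :=
    DifferentiableAt.comp (g := (Ring.inverse : (V →L[ℝ] V) → (V →L[ℝ] V)))
      (f := fun L : V →L[ℝ] E => (ContinuousLinearMap.adjoint L ∘L L : V →L[ℝ] V)) L
      (differentiableAt_inverse (isUnit_adjoint_comp_self hL)) h2
  exact differentiableAt_id.clm_comp (h3.clm_comp hadj)

end RangeProjection

/-! ### Differentials read in a chart. -/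

section Charts

variable {E : Type*} [NormedAddCommGroup E] [InnerProductSpace ℝ E]
  {n : ℕ} {P : Type*} [TopologicalSpace P] [ChartedSpace (EuclideanSpace ℝ (Fin n)) P]
  {V : Type*} [NormedAddCommGroup V] [NormedSpace ℝ V]

theorem differential_eq_fderiv {G : P → V} {p : P}
    (hG : MDifferentiableAt (𝓡 n) 𝓘(ℝ, V) G p) :
    differential n G p =
      fderiv ℝ (G ∘ (extChartAt (𝓡 n) p).symm) (extChartAt (𝓡 n) p p) := by
  refine hG.mfderiv.trans ?_
  simp only [writtenInExtChartAt, ModelWithCorners.range_eq_univ, fderivWithin_univ,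
    extChartAt_model_space_eq_id, PartialEquiv.refl_coe, Function.id_comp]
  rfl

theorem mdifferentiableAt_of_differentiableAt [IsManifold (𝓡 n) ∞ P] {G : P → V} {p : P}
    (hG : DifferentiableAt ℝ (G ∘ (extChartAt (𝓡 n) p).symm) (extChartAt (𝓡 n) p p)) :
    MDifferentiableAt (𝓡 n) 𝓘(ℝ, V) G p := by
  have hφ : MDifferentiableAt (𝓡 n) 𝓘(ℝ, EuclideanSpace ℝ (Fin n)) (extChartAt (𝓡 n) p) p :=
    have : IsManifold (𝓡 n) 1 P := IsManifold.of_le (n := ∞) (by norm_num)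
    mdifferentiableAt_extChartAt (mem_chart_source _ p)
  refine (hG.mdifferentiableAt.comp p hφ).congr_of_eventuallyEq ?_
  filter_upwards [extChartAt_source_mem_nhds (I := 𝓡 n) p] with q hq
  simp only [Function.comp_apply]
  rw [(extChartAt (𝓡 n) p).left_inv hq]

theorem contDiffAt_comp_extChartAt_symm [IsManifold (𝓡 n) ∞ P] {F : P → V}
    (hF : ContMDiff (𝓡 n) 𝓘(ℝ, V) ∞ F) (p : P) {y : EuclideanSpace ℝ (Fin n)}
    (hy : y ∈ (extChartAt (𝓡 n) p).target) :
    ContDiffAt ℝ ∞ (F ∘ (extChartAt (𝓡 n) p).symm) y := by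
  rw [← contMDiffAt_iff_contDiffAt]
  exact hF.contMDiffAt.comp y ((contMDiffOn_extChartAt_symm p).contMDiffAt
    ((isOpen_extChartAt_target p).mem_nhds hy))

/-- `differential` uses the preferred chart of each point, so it need not vary continuously. Near
`p` it differs from the derivative in the fixed chart at `p` only by an invertible change of
coordinates, which leaves the tangent plane unchanged. -/
theorem range_differential_eq [IsManifold (𝓡 n) ∞ P] {F : P → V}
    (hF : ContMDiff (𝓡 n) 𝓘(ℝ, V) ∞ F) {p : P} {y : EuclideanSpace ℝ (Fin n)}
    (hy : y ∈ (extChartAt (𝓡 n) p).target) :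
    ∃ A : EuclideanSpace ℝ (Fin n) ≃L[ℝ] EuclideanSpace ℝ (Fin n),
      differential n F ((extChartAt (𝓡 n) p).symm y) =
        fderiv ℝ (F ∘ (extChartAt (𝓡 n) p).symm) y ∘L (A : _ →L[ℝ] _) := by
  have : IsManifold (𝓡 n) 1 P := IsManifold.of_le (n := ∞) (by norm_num)
  set q := (extChartAt (𝓡 n) p).symm y with hq
  have hqs : q ∈ (extChartAt (𝓡 n) p).source := (extChartAt (𝓡 n) p).map_target hy
  have hφq : extChartAt (𝓡 n) p q = y := (extChartAt (𝓡 n) p).right_inv hy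
  obtain ⟨A, hA⟩ := isInvertible_mfderiv_extChartAt hqs
  refine ⟨A, ?_⟩
  have hf : MDifferentiableAt 𝓘(ℝ, EuclideanSpace ℝ (Fin n)) 𝓘(ℝ, V)
      (F ∘ (extChartAt (𝓡 n) p).symm) (extChartAt (𝓡 n) p q) := by
    rw [hφq]
    exact ((contDiffAt_comp_extChartAt_symm hF p hy).differentiableAt (by simp)).mdifferentiableAt
  have hφ : MDifferentiableAt (𝓡 n) 𝓘(ℝ, EuclideanSpace ℝ (Fin n)) (extChartAt (𝓡 n) p) q :=
    mdifferentiableAt_extChartAt (by simpa using hqs)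
  have hev : F =ᶠ[𝓝 q] (F ∘ (extChartAt (𝓡 n) p).symm) ∘ extChartAt (𝓡 n) p := by
    filter_upwards [(isOpen_extChartAt_source (I := 𝓡 n) p).mem_nhds hqs] with z hz
    simp only [Function.comp_apply]
    rw [(extChartAt (𝓡 n) p).left_inv hz]
  have h := mfderiv_comp q hf hφ
  rw [← hev.mfderiv_eq, mfderiv_eq_fderiv, hφq] at h
  rw [differential, h, ← hA]
  rfl

end Charts

/-! ### Weighted Laplacian of a restricted ambient function. -/

section WeightedLaplacian

variable {E : Type*} [NormedAddCommGroup E] [InnerProductSpace ℝ E] [CompleteSpace E]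
  {n : ℕ} {P : Type*} [TopologicalSpace P] [ChartedSpace (EuclideanSpace ℝ (Fin n)) P]
  {F : P → E}

theorem differential_comp_of_hasGradientAt {φ : E → ℝ} {X : E} {p : P}
    (hF : MDifferentiableAt (𝓡 n) 𝓘(ℝ, E) F p) (hφ : HasGradientAt φ X (F p))
    (v : EuclideanSpace ℝ (Fin n)) :
    differential n (fun q => φ (F q)) p v = ⟪X, differential n F p v⟫ := by
  have h := mfderiv_comp p hφ.hasFDerivAt.differentiableAt.mdifferentiableAt hF
  rw [mfderiv_eq_fderiv, hφ.hasFDerivAt.fderiv] at h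
  exact congrArg (fun T : EuclideanSpace ℝ (Fin n) →L[ℝ] ℝ => T v) h

theorem gradP_comp_of_hasGradientAt {φ : E → ℝ} {X : E} {p : P}
    (hF : MDifferentiableAt (𝓡 n) 𝓘(ℝ, E) F p) (hφ : HasGradientAt φ X (F p)) :
    gradP n F (fun q => φ (F q)) p = (tangentPlane n F p).starProjection X := by
  rw [gradP, Submodule.starProjection_apply,
    (stdOrthonormalBasis ℝ (tangentPlane n F p)).orthogonalProjectionOnto_apply_eq_sum]
  simp only [differential_comp_of_hasGradientAt hF hφ, differential_tangentFrame]
  simp [real_inner_comm]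

/-- The gradient on `P` is the tangential part of `X`. Differentiating the orthogonality of `X -
X^T` to the coordinate fields turns its divergence into the tangential trace of `DX` plus a second
fundamental form term. -/
theorem laplacianP_comp_of_hasGradientAt [IsManifold (𝓡 n) ∞ P] (hF : IsSmoothImmersion n F)
    {φ : E → ℝ} {X : E → E} (hφ : ∀ y, HasGradientAt φ (X y) y) {p : P}
    (hX : DifferentiableAt ℝ X (F p)) :
    laplacianP n F (fun q => φ (F q)) p =
      ∑ i, ⟪fderiv ℝ X (F p) (stdOrthonormalBasis ℝ (tangentPlane n F p) i : E),
        (stdOrthonormalBasis ℝ (tangentPlane n F p) i : E)⟫ +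
      ⟪X (F p), meanCurvatureVector n F p⟫ := by
  have hFd : ∀ q, MDifferentiableAt (𝓡 n) 𝓘(ℝ, E) F q := fun q =>
    (hF.contMDiff q).mdifferentiableAt (by simp)
  set f := F ∘ (extChartAt (𝓡 n) p).symm with hf
  set y₀ := extChartAt (𝓡 n) p p with hy₀
  have hy₀t : y₀ ∈ (extChartAt (𝓡 n) p).target := mem_extChartAt_target p
  have hfy₀ : f y₀ = F p := by simp [hf, hy₀]
  have hfc : ContDiffAt ℝ ∞ f y₀ := contDiffAt_comp_extChartAt_symm hF.contMDiff p hy₀t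
  have hdF : differential n F p = fderiv ℝ f y₀ := differential_eq_fderiv (hFd p)
  have hinj : Function.Injective (fderiv ℝ f y₀) := hdF ▸ hF.injective_differential p
  have hfd : DifferentiableAt ℝ f y₀ := hfc.differentiableAt (by simp)
  have hf2 : DifferentiableAt ℝ (fderiv ℝ f) y₀ :=
    (hfc.fderiv_right (m := 1) (by norm_cast)).differentiableAt (by simp)
  have hXf : DifferentiableAt ℝ (fun y => X (f y)) y₀ :=
    DifferentiableAt.comp y₀ (by rw [hfy₀]; exact hX) hfd
  -- The tangential part of `X` in the fixed chart at `p`, written so that its differentiability is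
  -- visible.
  set Z : EuclideanSpace ℝ (Fin n) → E := fun y => rangeProjection (fderiv ℝ f y) (X (f y))
    with hZ
  have hZd : DifferentiableAt ℝ Z y₀ :=
    (DifferentiableAt.comp (g := rangeProjection) y₀
      (differentiableAt_rangeProjection hinj) hf2).clm_apply hXf
  have htar : ∀ᶠ y in 𝓝 y₀, y ∈ (extChartAt (𝓡 n) p).target :=
    (isOpen_extChartAt_target p).mem_nhds hy₀t
  have hproj : ∀ y ∈ (extChartAt (𝓡 n) p).target,
      gradP n F (fun q => φ (F q)) ((extChartAt (𝓡 n) p).symm y) = Z y ∧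
      ∀ w, ⟪X (f y) - Z y, fderiv ℝ f y w⟫ = 0 := by
    intro y hy
    obtain ⟨A, hA⟩ := range_differential_eq hF.contMDiff hy
    set q := (extChartAt (𝓡 n) p).symm y
    have hLinj : Function.Injective (fderiv ℝ f y) := by
      intro v w hvw
      have := hF.injective_differential q (a₁ := A.symm v) (a₂ := A.symm w)
        (by rw [hA]; simpa [hf] using hvw)
      exact A.symm.injective this
    have hrange : tangentPlane n F q = LinearMap.range (fderiv ℝ f y).toLinearMap := by
      ext x
      constructor
      · rintro ⟨v, rfl⟩
        exact ⟨A v, by change _ = differential n F q v; rw [hA]; rfl⟩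
      · rintro ⟨v, rfl⟩
        exact ⟨A.symm v, by change differential n F q _ = fderiv ℝ f y v; rw [hA]; simp [hf]⟩
    have hP := starProjection_range_eq hLinj (tangentPlane n F q) hrange (X (F q))
    refine ⟨by rw [gradP_comp_of_hasGradientAt (hFd q) (hφ _), hP]; rfl, fun w => ?_⟩
    change ⟪X (F q) - rangeProjection (fderiv ℝ f y) (X (F q)), fderiv ℝ f y w⟫ = 0
    rw [← hP]
    refine Submodule.starProjection_inner_eq_zero _ _ ?_
    rw [hrange]
    exact ⟨w, rfl⟩
  have hev : (gradP n F (fun q => φ (F q))) ∘ (extChartAt (𝓡 n) p).symm =ᶠ[𝓝 y₀] Z :=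
    htar.mono fun y hy => (hproj y hy).1
  have hgd : differential n (gradP n F (fun q => φ (F q))) p = fderiv ℝ Z y₀ := by
    rw [differential_eq_fderiv (mdifferentiableAt_of_differentiableAt
      (hZd.congr_of_eventuallyEq hev)), hev.fderiv_eq]
  have hkey : ∀ v w, ⟪fderiv ℝ Z y₀ v, fderiv ℝ f y₀ w⟫ =
      ⟪fderiv ℝ X (F p) (fderiv ℝ f y₀ v), fderiv ℝ f y₀ w⟫ +
      ⟪X (F p) - Z y₀, fderiv ℝ (fderiv ℝ f) y₀ v w⟫ := by
    intro v w
    have h0 : (fun y => ⟪X (f y) - Z y, fderiv ℝ f y w⟫) =ᶠ[𝓝 y₀] fun _ => (0 : ℝ) :=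
      htar.mono fun y hy => (hproj y hy).2 w
    have h1 := h0.fderiv_eq (𝕜 := ℝ)
    have hXd : HasFDerivAt (fun y => X (f y)) ((fderiv ℝ X (F p)).comp (fderiv ℝ f y₀)) y₀ := by
      refine HasFDerivAt.comp y₀ ?_ hfd.hasFDerivAt
      rw [hfy₀]; exact hX.hasFDerivAt
    have h2 := ((hXd.sub hZd.hasFDerivAt).inner ℝ
      (hf2.hasFDerivAt.clm_apply (hasFDerivAt_const w y₀))).fderiv
    have h3 := (h2.symm.trans h1)
    have h4 := congrArg (fun T : EuclideanSpace ℝ (Fin n) →L[ℝ] ℝ => T v) h3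
    simp [hfy₀, inner_sub_left] at h4
    rw [inner_sub_left]
    linarith
  have hZ₀ : Z y₀ = (tangentPlane n F p).starProjection (X (F p)) := by
    rw [← (hproj y₀ hy₀t).1, hy₀, extChartAt_to_inv, gradP_comp_of_hasGradientAt (hFd p) (hφ _)]
  -- At `p` the vector `X - Z` is the normal part of `X`, so pairing with it keeps only the normal
  -- part of the second derivative of `F`.
  have hnormal : ∀ x, ⟪X (F p) - Z y₀, x⟫ = ⟪X (F p), normalPart n F p x⟫ := by
    intro x
    rw [hZ₀, normalPart, inner_sub_left, inner_sub_right,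
      Submodule.inner_starProjection_left_eq_right]
  rw [laplacianP, divP, meanCurvatureVector, inner_sum, ← Finset.sum_add_distrib]
  refine Finset.sum_congr rfl fun i _ => ?_
  rw [hgd, ← differential_tangentFrame, hdF, hkey, hnormal]
  rfl

theorem weightedLaplacianP_comp_of_hasGradientAt [IsManifold (𝓡 n) ∞ P]
    (hF : IsSmoothImmersion n F) {h φ : E → ℝ} {X : E → E} (hφ : ∀ y, HasGradientAt φ (X y) y)
    {p : P} (hX : DifferentiableAt ℝ X (F p)) (hh : DifferentiableAt ℝ h (F p)) :
    weightedLaplacianP n F h (fun q => φ (F q)) p =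
      ∑ i, ⟪fderiv ℝ X (F p) (stdOrthonormalBasis ℝ (tangentPlane n F p) i : E),
        (stdOrthonormalBasis ℝ (tangentPlane n F p) i : E)⟫ +
      ⟪X (F p), weightedMeanCurvatureVector n F h p + gradient h (F p)⟫ := by
  have hFd : MDifferentiableAt (𝓡 n) 𝓘(ℝ, E) F p := (hF.contMDiff p).mdifferentiableAt (by simp)
  rw [weightedLaplacianP, laplacianP_comp_of_hasGradientAt hF hφ hX,
    gradP_comp_of_hasGradientAt hFd (hφ _), gradP_comp_of_hasGradientAt hFd hh.hasGradientAt,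
    weightedMeanCurvatureVector, normalPart, add_assoc]
  congr 1
  -- The drift pairs two tangential parts, and one projection suffices. The remaining `(∇h)^T`
  -- combines with `nH` into `H^h + ∇h`.
  have h1 : ⟪(tangentPlane n F p).starProjection (gradient h (F p)),
      (tangentPlane n F p).starProjection (X (F p))⟫ =
      ⟪X (F p), (tangentPlane n F p).starProjection (gradient h (F p))⟫ := by
    rw [← Submodule.inner_starProjection_left_eq_right, real_inner_comm,
      Submodule.starProjection_eq_self_iff.mpr (Submodule.starProjection_apply_mem _ _)]
  rw [h1, ← inner_add_right]
  congr 1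
  abel

end WeightedLaplacian

/-! ### Lifting segments through a local isometry. -/

section Lifting

variable {E : Type*} [NormedAddCommGroup E] [InnerProductSpace ℝ E]
  {n : ℕ} {P : Type*} [TopologicalSpace P] [ChartedSpace (EuclideanSpace ℝ (Fin n)) P]

/-- `e` is a local inverse of `G` around `p` which is differentiable at `G p`. -/
structure IsLocalInverseAt {W : Type*} [NormedAddCommGroup W] [NormedSpace ℝ W] (n : ℕ)
    [ChartedSpace (EuclideanSpace ℝ (Fin n)) P]
    (G : P → W) (p : P) (e : OpenPartialHomeomorph P W) : Prop where
  mem_source : p ∈ e.source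
  eqOn : Set.EqOn G e e.source
  contMDiffAt_symm : ContMDiffAt 𝓘(ℝ, W) (𝓡 n) 1 e.symm (G p)

/-- The inverse function theorem for maps from a manifold to a normed space. -/
theorem exists_isLocalInverseAt [IsManifold (𝓡 n) ∞ P] {W : Type*} [NormedAddCommGroup W]
    [NormedSpace ℝ W] [CompleteSpace W] {G : P → W} (hG : ContMDiff (𝓡 n) 𝓘(ℝ, W) ∞ G) {p : P}
    (hb : Function.Bijective (differential n G p)) :
    ∃ e : OpenPartialHomeomorph P W, IsLocalInverseAt n G p e := by
  have : IsManifold (𝓡 n) 1 P := IsManifold.of_le (n := ∞) (by norm_num)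
  set f := G ∘ (extChartAt (𝓡 n) p).symm with hf
  set y₀ := extChartAt (𝓡 n) p p with hy₀
  have hy₀t : y₀ ∈ (extChartAt (𝓡 n) p).target := mem_extChartAt_target p
  have hfc : ContDiffAt ℝ ∞ f y₀ := contDiffAt_comp_extChartAt_symm hG p hy₀t
  have hd : differential n G p = fderiv ℝ f y₀ :=
    differential_eq_fderiv ((hG p).mdifferentiableAt (by simp))
  rw [hd] at hb
  let L : EuclideanSpace ℝ (Fin n) ≃L[ℝ] W :=
    ContinuousLinearEquiv.ofBijective (fderiv ℝ f y₀) (LinearMap.ker_eq_bot.mpr hb.1)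
      (LinearMap.range_eq_top.mpr hb.2)
  have hL : HasFDerivAt f (L : EuclideanSpace ℝ (Fin n) →L[ℝ] W) y₀ := by
    rw [ContinuousLinearEquiv.coe_ofBijective]
    exact (hfc.differentiableAt (by simp)).hasFDerivAt
  have hfy₀ : f y₀ = G p := by simp [hf, hy₀]
  let e₁ := hfc.toOpenPartialHomeomorph f hL (by simp)
  have hy₀s : y₀ ∈ e₁.source := hfc.mem_toOpenPartialHomeomorph_source hL (by simp)
  have hsymm : e₁.symm (G p) = y₀ := by
    rw [← hfy₀]; exact e₁.left_inv hy₀s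
  refine ⟨(chartAt (EuclideanSpace ℝ (Fin n)) p).trans e₁, ?_, ?_, ?_⟩
  · rw [OpenPartialHomeomorph.trans_source]
    exact ⟨mem_chart_source _ p, hy₀s⟩
  · intro q hq
    rw [OpenPartialHomeomorph.trans_source] at hq
    change G q = G ((chartAt (EuclideanSpace ℝ (Fin n)) p).symm
      (chartAt (EuclideanSpace ℝ (Fin n)) p q))
    rw [(chartAt (EuclideanSpace ℝ (Fin n)) p).left_inv hq.1]
  · have h1 : ContMDiffAt 𝓘(ℝ, EuclideanSpace ℝ (Fin n)) (𝓡 n) 1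
        (extChartAt (𝓡 n) p).symm (e₁.symm (G p)) := by
      rw [hsymm]
      exact (contMDiffOn_extChartAt_symm p).contMDiffAt
        ((isOpen_extChartAt_target p).mem_nhds hy₀t)
    have h2 : ContDiffAt ℝ 1 e₁.symm (G p) := by
      rw [← hfy₀]
      exact (hfc.to_localInverse hL (by simp)).of_le (by norm_cast)
    exact h1.comp (G p) h2.contMDiffAt

/-- The norm on the tangent spaces of `P` induced by `F`. -/
@[reducible]
noncomputable def inducedENorm (n : ℕ) [ChartedSpace (EuclideanSpace ℝ (Fin n)) P] (F : P → E)
    (x : P) : ENorm (TangentSpace (𝓡 n) x) :=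
  ⟨fun v => ‖differential n F x v‖ₑ⟩

theorem enormSMulClass_inducedENorm (F : P → E) (x : P) :
    letI := inducedENorm n F x
    ENormSMulClass ℝ (TangentSpace (𝓡 n) x) :=
  letI := inducedENorm n F x
  ⟨fun r v => (congrArg enorm ((differential n F x).map_smul r v)).trans
    (enorm_smul r (differential n F x v))⟩

theorem inducedEDist_comm (F : P → E) (p q : P) :
    inducedEDist n F p q = inducedEDist n F q p := by
  let := inducedENorm n F
  have := enormSMulClass_inducedENorm (n := n) F
  exact Manifold.riemannianEDist_comm

/-- The image under `F` moves with constant velocity `v`, so the length of `γ` in the induced metric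
is `‖v‖ (b - a)`. -/
theorem inducedEDist_le_of_line {F : P → E} (hF : ContMDiff (𝓡 n) 𝓘(ℝ, E) ∞ F) {γ : ℝ → P}
    {a b : ℝ} (hab : a ≤ b) (hγ : ContMDiffOn 𝓘(ℝ, ℝ) (𝓡 n) 1 γ (Set.Icc a b)) {x v : E}
    (hline : ∀ t ∈ Set.Icc a b, F (γ t) = x + t • v) :
    inducedEDist n F (γ a) (γ b) ≤ ‖v‖ₑ * ENNReal.ofReal (b - a) := by
  let := inducedENorm n F
  have := enormSMulClass_inducedENorm (n := n) F
  refine (Manifold.riemannianEDist_le_pathELength hγ rfl rfl hab).trans ?_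
  rw [Manifold.pathELength_eq_lintegral_mfderiv_Ioo]
  have h : ∀ t ∈ Set.Ioo a b, ‖mfderiv 𝓘(ℝ, ℝ) (𝓡 n) γ t (1 : ℝ)‖ₑ = ‖v‖ₑ := by
    intro t ht
    have hnhds : Set.Icc a b ∈ 𝓝 t := Icc_mem_nhds ht.1 ht.2
    have hγt : MDifferentiableAt 𝓘(ℝ, ℝ) (𝓡 n) γ t :=
      (hγ.contMDiffAt hnhds).mdifferentiableAt (by simp)
    have h1 := mfderiv_comp t ((hF (γ t)).mdifferentiableAt (by simp)) hγt
    have hev : F ∘ γ =ᶠ[𝓝 t] fun s => x + s • v := by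
      filter_upwards [hnhds] with s hs using hline s hs
    have h2 : HasFDerivAt (F ∘ γ) ((1 : ℝ →L[ℝ] ℝ).smulRight v) t :=
      (((hasFDerivAt_id t).smul_const v).const_add x).congr_of_eventuallyEq hev
    rw [mfderiv_eq_fderiv, h2.fderiv] at h1
    have h3 := congrArg (fun T : ℝ →L[ℝ] E => T 1) h1
    change (1 : ℝ) • v = differential n F (γ t) (mfderiv 𝓘(ℝ, ℝ) (𝓡 n) γ t (1 : ℝ)) at h3
    change ‖differential n F (γ t) (mfderiv 𝓘(ℝ, ℝ) (𝓡 n) γ t (1 : ℝ))‖ₑ = ‖v‖ₑ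
    rw [← h3, one_smul]
  refine (MeasureTheory.setLIntegral_congr_fun measurableSet_Ioo h).le.trans ?_
  simp

/-- `γ` lifts the segment `t ↦ G p₀ + t • v`, `0 ≤ t ≤ T`, through `G`, starting at `p₀`. -/
structure IsLineLift {W : Type*} [NormedAddCommGroup W] [NormedSpace ℝ W]
    (G : P → W) (p₀ : P) (v : W) (T : ℝ) (γ : ℝ → P) : Prop where
  continuousOn : ContinuousOn γ (Set.Icc 0 T)
  start : γ 0 = p₀
  lifts : ∀ t ∈ Set.Icc 0 T, G (γ t) = G p₀ + t • v

section

variable {W : Type*} [NormedAddCommGroup W] [NormedSpace ℝ W] {G : P → W} {p₀ : P} {v : W}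

theorem IsLineLift.mono {T T' : ℝ} {γ : ℝ → P} (h : IsLineLift G p₀ v T γ) (hT : T' ≤ T) :
    IsLineLift G p₀ v T' γ :=
  ⟨h.continuousOn.mono (Set.Icc_subset_Icc_right hT), h.start,
    fun t ht => h.lifts t ⟨ht.1, ht.2.trans hT⟩⟩

theorem IsLineLift.eqOn [T2Space P] (hG : IsLocalHomeomorph G) {T : ℝ} (hT : 0 ≤ T) {γ δ : ℝ → P}
    (h : IsLineLift G p₀ v T γ) (h' : IsLineLift G p₀ v T δ) : Set.EqOn γ δ (Set.Icc 0 T) :=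
  (T2Space.isSeparatedMap G).eqOn_of_comp_eqOn hG.isLocallyInjective isPreconnected_Icc
    h.continuousOn h'.continuousOn (fun t ht => (h.lifts t ht).trans (h'.lifts t ht).symm)
    (Set.left_mem_Icc.mpr hT) (h.start.trans h'.start.symm)

/-- Near each time the lift is a local inverse applied to the segment. This regularity is needed to
measure its length. -/
theorem IsLineLift.contMDiffOn (hG : ∀ p, ∃ e, IsLocalInverseAt n G p e) {T : ℝ} {γ : ℝ → P}
    (h : IsLineLift G p₀ v T γ) : ContMDiffOn 𝓘(ℝ, ℝ) (𝓡 n) 1 γ (Set.Icc 0 T) := by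
  intro t ht
  obtain ⟨e, he⟩ := hG (γ t)
  have hline : ContMDiffAt 𝓘(ℝ, ℝ) 𝓘(ℝ, W) 1 (fun t : ℝ => G p₀ + t • v) t := by
    rw [contMDiffAt_iff_contDiffAt]; fun_prop
  have hs : ContMDiffAt 𝓘(ℝ, ℝ) (𝓡 n) 1 (fun t : ℝ => e.symm (G p₀ + t • v)) t := by
    refine ContMDiffAt.comp t (I' := 𝓘(ℝ, W)) ?_ hline
    rw [← h.lifts t ht]; exact he.contMDiffAt_symm
  have hev : ∀ᶠ s in 𝓝[Set.Icc 0 T] t, γ s = e.symm (G p₀ + s • v) := by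
    filter_upwards [h.continuousOn t ht (e.open_source.mem_nhds he.mem_source),
      self_mem_nhdsWithin] with s hs hsT
    rw [← h.lifts s hsT, he.eqOn hs, e.left_inv hs]
  exact hs.contMDiffWithinAt.congr_of_eventuallyEq hev (hev.self_of_nhdsWithin ht)

theorem IsLineLift.extend {T T' : ℝ} (hT : 0 ≤ T) (hTT' : T ≤ T') {γ : ℝ → P}
    (h : IsLineLift G p₀ v T γ) {e : OpenPartialHomeomorph P W} (he : Set.EqOn G e e.source)
    (hγT : γ T ∈ e.source) (htar : ∀ t ∈ Set.Icc T T', G p₀ + t • v ∈ e.target) :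
    ∃ δ, IsLineLift G p₀ v T' δ := by
  have hsT : e.symm (G p₀ + T • v) = γ T := by
    rw [← h.lifts T ⟨hT, le_rfl⟩, he hγT, e.left_inv hγT]
  refine ⟨fun t => if t ≤ T then γ t else e.symm (G p₀ + t • v), ?_, ?_, ?_⟩
  · have hδ : ∀ t ∈ Set.Icc T T',
        (if t ≤ T then γ t else e.symm (G p₀ + t • v)) = e.symm (G p₀ + t • v) := by
      intro t ht
      split_ifs with htT
      · rw [le_antisymm htT ht.1, hsT]
      · rfl
    rw [← Set.Icc_union_Icc_eq_Icc hT hTT']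
    refine ContinuousOn.union_of_isClosed ?_ ?_ isClosed_Icc isClosed_Icc
    · exact h.continuousOn.congr fun t ht => if_pos ht.2
    · refine ContinuousOn.congr ?_ hδ
      exact e.continuousOn_symm.comp (by fun_prop) htar
  · rw [if_pos hT, h.start]
  · intro t ht
    split_ifs with htT
    · exact h.lifts t ⟨ht.1, htT⟩
    · have hmem := htar t ⟨(not_le.mp htT).le, ht.2⟩
      rw [he (e.map_target hmem), e.right_inv hmem]

end

theorem isLocalHomeomorph_of_isLocalInverseAt {W : Type*} [NormedAddCommGroup W]
    [NormedSpace ℝ W] {G : P → W} (hG : ∀ p, ∃ e, IsLocalInverseAt n G p e) :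
    IsLocalHomeomorph G :=
  IsLocalHomeomorph.mk G fun p => (hG p).imp fun _ he => ⟨he.mem_source, he.eqOn⟩

/-- A continuity argument on the times up to which a lift exists. Endpoints of lifts at times
increasing to the supremum form a Cauchy sequence; completeness gives a limit, and a local inverse
there carries a lift past the supremum. -/
theorem exists_isLineLift [T2Space P] {F : P → E} (hF : ContMDiff (𝓡 n) 𝓘(ℝ, E) ∞ F)
    (hcomplete : IsCompleteSubmanifold n F) {W : Submodule ℝ E} {G : P → W} {c : E}
    (hFG : ∀ p, F p = c + G p) (hG : ∀ p, ∃ e, IsLocalInverseAt n G p e) (p₀ : P) (v : W)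
    {T : ℝ} (hT : 0 ≤ T) : ∃ γ, IsLineLift G p₀ v T γ := by
  have hloc := isLocalHomeomorph_of_isLocalInverseAt hG
  have hcont : Continuous fun t : ℝ => G p₀ + t • v := by fun_prop
  by_contra hTS
  set S : Set ℝ := {t | 0 ≤ t ∧ ∃ γ, IsLineLift G p₀ v t γ} with hS
  have hdown : ∀ t ∈ S, ∀ s, 0 ≤ s → s ≤ t → s ∈ S :=
    fun t ht s hs hst => ⟨hs, ht.2.imp fun γ hγ => hγ.mono hst⟩
  have h0S : (0 : ℝ) ∈ S := ⟨le_rfl, fun _ => p₀, continuousOn_const, rfl, fun t ht => by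
    rw [le_antisymm ht.2 ht.1, zero_smul, add_zero]⟩
  have hbdd : BddAbove S := ⟨T, fun t ht => by
    by_contra hlt
    exact hTS (hdown t ht T hT (not_le.mp hlt).le).2⟩
  set τ := sSup S with hτ
  have hτ0 : 0 ≤ τ := le_csSup hbdd h0S
  have hlt : ∀ t, 0 ≤ t → t < τ → t ∈ S := fun t h0 ht => by
    obtain ⟨s, hs, hts⟩ := exists_lt_of_lt_csSup ⟨0, h0S⟩ ht
    exact hdown s hs t h0 hts.le
  -- it suffices to find a local inverse around a limit point of lifts
  have hstep : ∀ (p : P) (t : ℕ → ℝ) (γ : ℕ → ℝ → P), Filter.Tendsto t Filter.atTop (𝓝 τ) →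
      (∀ k, t k ≤ τ) → (∀ k, 0 ≤ t k) → (∀ k, IsLineLift G p₀ v (t k) (γ k)) →
      Filter.Tendsto (fun k => γ k (t k)) Filter.atTop (𝓝 p) → False := by
    intro p t γ ht htτ ht0 hγ hp
    obtain ⟨e, he⟩ := hG p
    have hGp : G p = G p₀ + τ • v := by
      refine tendsto_nhds_unique ((hloc.continuous.tendsto p).comp hp) ?_
      refine ((hcont.tendsto τ).comp ht).congr fun k => ?_
      exact ((hγ k).lifts (t k) ⟨ht0 k, le_rfl⟩).symm
    have hmem : G p₀ + τ • v ∈ e.target := by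
      rw [← hGp, he.eqOn he.mem_source]; exact e.map_source he.mem_source
    obtain ⟨ε, hε, hball⟩ := Metric.mem_nhds_iff.mp
      (hcont.continuousAt.preimage_mem_nhds (e.open_target.mem_nhds hmem))
    obtain ⟨k, hk1, hk2⟩ := ((hp.eventually (e.open_source.mem_nhds he.mem_source)).and
      (ht.eventually (Metric.ball_mem_nhds τ hε))).exists
    have hk2' : |t k - τ| < ε := hk2
    -- Once `t k` is within `ε` of `τ`, the whole stretch from `t k` to `τ + ε / 2` stays in the
    -- target of the local inverse.
    have hext := (hγ k).extend (T' := τ + ε / 2) (ht0 k) (by linarith [htτ k]) he.eqOn hk1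
      (fun s hs => hball (by
        rw [Metric.mem_ball, Real.dist_eq, abs_lt]
        rw [abs_lt] at hk2'
        constructor <;> linarith [hs.1, hs.2]))
    have : τ + ε / 2 ≤ τ := le_csSup hbdd ⟨by linarith, hext⟩
    linarith
  by_cases hτS : τ ∈ S
  · obtain ⟨γ, hγ⟩ := hτS.2
    exact hstep (γ τ) (fun _ => τ) (fun _ => γ) tendsto_const_nhds (fun _ => le_rfl)
      (fun _ => hτ0) (fun _ => hγ) tendsto_const_nhds
  have hτpos : 0 < τ := lt_of_le_of_ne hτ0 fun h => hτS (h ▸ h0S)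
  obtain ⟨t, htmono, htlt, htt⟩ := exists_seq_strictMono_tendsto' hτpos
  have htS : ∀ k, t k ∈ S := fun k => hlt _ (htlt k).1.le (htlt k).2
  choose γ hγ using fun k => (htS k).2
  have hdist : ∀ i j, i ≤ j → inducedEDist n F (γ i (t i)) (γ j (t j)) ≤
      ‖(v : E)‖ₑ * ENNReal.ofReal (t j - t i) := by
    intro i j hij
    have htij : t i ≤ t j := htmono.monotone hij
    -- The lifts are chosen independently; uniqueness places their endpoints on a common curve.
    have heq : γ i (t i) = γ j (t i) :=
      (hγ i).eqOn hloc (htlt i).1.le ((hγ j).mono htij) ⟨(htlt i).1.le, le_rfl⟩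
    rw [heq]
    have hsub : Set.Icc (t i) (t j) ⊆ Set.Icc 0 (t j) := Set.Icc_subset_Icc_left (htlt i).1.le
    refine inducedEDist_le_of_line hF htij (((hγ j).contMDiffOn hG).mono hsub)
      (x := c + G p₀) fun s hs => ?_
    rw [hFG, (hγ j).lifts s (hsub hs), Submodule.coe_add, Submodule.coe_smul, add_assoc]
  have hdist' : ∀ N i j, N ≤ i → N ≤ j → inducedEDist n F (γ i (t i)) (γ j (t j)) ≤
      ‖(v : E)‖ₑ * ENNReal.ofReal (τ - t N) := by
    intro N i j hi hj
    have hbound : ∀ i j, N ≤ i → ‖(v : E)‖ₑ * ENNReal.ofReal (t j - t i) ≤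
        ‖(v : E)‖ₑ * ENNReal.ofReal (τ - t N) := fun i j hi =>
      mul_le_mul_right (ENNReal.ofReal_le_ofReal
        (by linarith [htmono.monotone hi, (htlt j).2])) _
    rcases le_total i j with hij | hij
    · exact (hdist i j hij).trans (hbound i j hi)
    · rw [inducedEDist_comm]
      exact (hdist j i hij).trans (hbound j i hj)
  obtain ⟨p, hp⟩ := hcomplete (fun k => γ k (t k)) (by
    intro ε hε
    have hlim : Filter.Tendsto (fun N => ‖(v : E)‖ₑ * ENNReal.ofReal (τ - t N)) Filter.atTop
        (𝓝 0) := by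
      have h1 : Filter.Tendsto (fun N => ENNReal.ofReal (τ - t N)) Filter.atTop (𝓝 0) := by
        have := ENNReal.tendsto_ofReal (htt.const_sub τ)
        simpa using this
      simpa using ENNReal.Tendsto.const_mul h1 (Or.inr enorm_ne_top)
    obtain ⟨N, hN⟩ := (hlim.eventually (gt_mem_nhds hε)).exists
    exact ⟨N, fun i hi j hj => (hdist' N i j hi hj).trans_lt hN⟩)
  exact hstep p t γ htt (fun k => (htlt k).2.le) (fun k => (htlt k).1.le) hγ hp

/-- A local isometry from a complete connected manifold onto a Euclidean space is a bijection. -/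
theorem bijective_of_isCompleteSubmanifold [T2Space P] [ConnectedSpace P] {F : P → E}
    (hF : ContMDiff (𝓡 n) 𝓘(ℝ, E) ∞ F) (hcomplete : IsCompleteSubmanifold n F)
    {W : Submodule ℝ E} {G : P → W} {c : E} (hFG : ∀ p, F p = c + G p)
    (hG : ∀ p, ∃ e, IsLocalInverseAt n G p e) : Function.Bijective G := by
  have hloc := isLocalHomeomorph_of_isLocalInverseAt hG
  obtain ⟨p₀⟩ : Nonempty P := inferInstance
  choose γ hγ using fun v : W => exists_isLineLift hF hcomplete hFG hG p₀ v zero_le_one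
  let f : C(unitInterval × W, W) := ⟨fun x => G p₀ + (x.1 : ℝ) • x.2, by fun_prop⟩
  have hcont : Continuous fun x : unitInterval × W => γ x.2 x.1 := by
    refine hloc.continuous_lift (T2Space.isSeparatedMap G) f ?_ ?_ ?_
    · ext x : 1
      exact (hγ x.2).lifts x.1 x.1.2
    · simp only [Set.Icc.coe_zero, (hγ _).start]
      exact continuous_const
    · exact fun v => (hγ v).continuousOn.comp_continuous continuous_subtype_val Subtype.prop
  -- Endpoints of the lifted segments: up to translation, a continuous global section of `G`.
  set s : W → P := fun v => γ v 1 with hs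
  have hscont : Continuous s := hcont.comp (Continuous.prodMk_right (1 : unitInterval))
  have hsG : ∀ v, G (s v) = G p₀ + v := fun v => by
    simpa using (hγ v).lifts 1 ⟨zero_le_one, le_rfl⟩
  have hsloc : IsLocalHomeomorph s := by
    refine IsLocalHomeomorph.of_comp ?_ hloc hscont
    rw [show G ∘ s = Homeomorph.addLeft (G p₀) from funext hsG]
    exact (Homeomorph.addLeft (G p₀)).isLocalHomeomorph
  have hrange : Set.range s = {p | s (G p - G p₀) = p} := by
    ext p
    constructor
    · rintro ⟨v, rfl⟩
      simp [hsG]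
    · exact fun h => ⟨_, h⟩
  -- Open because `s` is a local homeomorphism, closed because it is an equalizer in a Hausdorff
  -- space. By connectedness `s` is onto, so it inverts `G` up to translation.
  have hclopen : IsClopen (Set.range s) := by
    refine ⟨?_, hsloc.isOpenMap.isOpen_range⟩
    rw [hrange]
    exact isClosed_eq (hscont.comp (hloc.continuous.sub continuous_const)) continuous_id
  have huniv := hclopen.eq_univ (Set.range_nonempty s)
  have hinv : ∀ p, s (G p - G p₀) = p := fun p => by
    have : p ∈ Set.range s := huniv ▸ Set.mem_univ p
    rwa [hrange] at this
  refine ⟨fun p q h => ?_, fun w => ⟨s (w - G p₀), by rw [hsG]; abel⟩⟩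
  rw [← hinv p, h, hinv]

end Lifting

/-! ### Tangent dimension and functions with vanishing differential. -/

section Immersion

variable {E : Type*} [NormedAddCommGroup E] [InnerProductSpace ℝ E]
  {n : ℕ} {P : Type*} [TopologicalSpace P] [ChartedSpace (EuclideanSpace ℝ (Fin n)) P] {F : P → E}

theorem finrank_tangentPlane (hF : IsSmoothImmersion n F) (p : P) :
    Module.finrank ℝ (tangentPlane n F p) = n := by
  rw [tangentPlane, LinearMap.finrank_range_of_inj (hF.injective_differential p),
    finrank_euclideanSpace_fin]

theorem hasFDerivAt_one_add_norm_sq_rpow (r : ℝ) (y : E) :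
    HasFDerivAt (fun y : E => (1 + ‖y‖ ^ 2) ^ r)
      ((2 * r * (1 + ‖y‖ ^ 2) ^ (r - 1)) • innerSL ℝ y) y := by
  have h1 : HasFDerivAt (fun y : E => 1 + ‖y‖ ^ 2) (2 • innerSL ℝ y) y :=
    (hasStrictFDerivAt_norm_sq y).hasFDerivAt.const_add 1
  have h2 := (Real.hasDerivAt_rpow_const (p := r) (Or.inl (by positivity :
    (1 + ‖y‖ ^ 2 : ℝ) ≠ 0))).comp_hasFDerivAt y h1
  refine h2.congr_fderiv ?_
  ext v
  change r * (1 + ‖y‖ ^ 2) ^ (r - 1) * (2 • ⟪y, v⟫) = 2 * r * (1 + ‖y‖ ^ 2) ^ (r - 1) * ⟪y, v⟫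
  rw [nsmul_eq_mul, Nat.cast_ofNat]
  ring

/-- A function of the position whose differential vanishes along a connected submanifold is
constant. -/
theorem exists_comp_eq_of_hasFDerivAt_zero [IsManifold (𝓡 n) ∞ P] [ConnectedSpace P]
    (hF : IsSmoothImmersion n F)
    {φ : E → ℝ} (hφ : ∀ p, HasFDerivAt φ (0 : E →L[ℝ] ℝ) (F p)) : ∃ k, ∀ p, φ (F p) = k := by
  have hloc : IsLocallyConstant fun p => φ (F p) := by
    rw [IsLocallyConstant.iff_eventually_eq]
    intro p
    obtain ⟨ε, hε, hball⟩ := Metric.isOpen_iff.mp (isOpen_extChartAt_target (I := 𝓡 n) p)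
      _ (mem_extChartAt_target p)
    have hd : ∀ y ∈ Metric.ball (extChartAt (𝓡 n) p p) ε,
        HasFDerivAt (fun y => φ (F ((extChartAt (𝓡 n) p).symm y)))
          (0 : EuclideanSpace ℝ (Fin n) →L[ℝ] ℝ) y := by
      intro y hy
      have h1 := (hφ ((extChartAt (𝓡 n) p).symm y)).comp (g := φ)
        (f := F ∘ (extChartAt (𝓡 n) p).symm) y
        ((contDiffAt_comp_extChartAt_symm hF.contMDiff p (hball hy)).differentiableAt
          (by simp)).hasFDerivAt
      rwa [ContinuousLinearMap.zero_comp] at h1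
    filter_upwards [extChartAt_source_mem_nhds (I := 𝓡 n) p,
      (continuousAt_extChartAt (I := 𝓡 n) p).preimage_mem_nhds (Metric.ball_mem_nhds _ hε)]
      with q hq hqb
    have h2 := Metric.isOpen_ball.is_const_of_fderiv_eq_zero (𝕜 := ℝ)
      (convex_ball _ _).isPreconnected
      (fun y hy => (hd y hy).differentiableAt.differentiableWithinAt)
      (fun y hy => (hd y hy).fderiv) hqb (Metric.mem_ball_self hε)
    simpa only [(extChartAt (𝓡 n) p).left_inv hq, extChartAt_to_inv] using h2
  obtain ⟨p₀⟩ : Nonempty P := inferInstance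
  exact ⟨φ (F p₀), fun p => hloc.apply_eq_of_preconnectedSpace p p₀⟩

end Immersion

/-! ### Consequences of parabolicity and of completeness. -/

section Parabolic

variable {E : Type*} [NormedAddCommGroup E] [InnerProductSpace ℝ E] [CompleteSpace E]
  {n : ℕ} {P : Type*} [TopologicalSpace P] [ChartedSpace (EuclideanSpace ℝ (Fin n)) P]
  [IsManifold (𝓡 n) ∞ P] {F : P → E} {h : E → ℝ}

theorem hasGradientAt_inner_const (b y : E) : HasGradientAt (fun y : E => ⟪y, b⟫) b y := by
  rw [hasGradientAt_iff_hasFDerivAt]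
  refine (InnerProductSpace.toDual ℝ E b).hasFDerivAt.congr_of_eventuallyEq
    (Filter.Eventually.of_forall fun z => ?_)
  simp [real_inner_comm]

theorem weightedLaplacianP_inner_const (hF : IsSmoothImmersion n F) (b : E) {p : P}
    (hh : DifferentiableAt ℝ h (F p)) :
    weightedLaplacianP n F h (fun q => ⟪F q, b⟫) p =
      ⟪b, weightedMeanCurvatureVector n F h p + gradient h (F p)⟫ := by
  rw [weightedLaplacianP_comp_of_hasGradientAt hF (X := fun _ => b) (hasGradientAt_inner_const b)
    (differentiableAt_const _) hh]
  simp

theorem weightedLaplacianP_const (hF : IsSmoothImmersion n F) (k : ℝ) {p : P}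
    (hh : DifferentiableAt ℝ h (F p)) : weightedLaplacianP n F h (fun _ => k) p = 0 := by
  have := weightedLaplacianP_comp_of_hasGradientAt hF (X := fun _ => 0)
    (fun y => hasGradientAt_const y k) (differentiableAt_const _) hh
  simpa using this

/-- In an `h`-parabolic submanifold lying in a half-space, a linear function which is
`h`-subharmonic is constant, hence `h`-harmonic. -/
theorem IsWeightedParabolic.exists_inner_eq (hP : IsWeightedParabolic n F h)
    (hF : IsSmoothImmersion n F) (hh : Differentiable ℝ h) {b : E} {t₀ : ℝ}
    (hbdd : ∀ p, ⟪F p, b⟫ ≤ t₀)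
    (hsub : ∀ p, 0 ≤ ⟪b, weightedMeanCurvatureVector n F h p + gradient h (F p)⟫) :
    ∃ s, (∀ p, ⟪F p, b⟫ = s) ∧
      ∀ p, ⟪b, weightedMeanCurvatureVector n F h p + gradient h (F p)⟫ = 0 := by
  have hu : ContMDiff (𝓡 n) 𝓘(ℝ, ℝ) 2 fun q => ⟪F q, b⟫ := by
    have hb : ContDiff ℝ ∞ fun y : E => ⟪y, b⟫ := contDiff_id.inner ℝ contDiff_const
    exact (hb.contMDiff.comp hF.contMDiff).of_le (by norm_cast)
  obtain ⟨s, hs⟩ := hP _ hu ⟨t₀, by rintro _ ⟨p, rfl⟩; exact hbdd p⟩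
    fun p => by rw [weightedLaplacianP_inner_const hF b (hh _)]; exact hsub p
  refine ⟨s, hs, fun p => ?_⟩
  rw [← weightedLaplacianP_inner_const hF b (hh _), funext hs, weightedLaplacianP_const hF s (hh _)]

/-- The function `-(1 + |y|²)^{-1/2}` is subharmonic on the submanifolds of dimension at least
three on which the weighted mean curvature vector balances the gradient of the weight. -/
theorem IsWeightedParabolic.exists_norm_eq (hP : IsWeightedParabolic n F h)
    (hF : IsSmoothImmersion n F) (hh : Differentiable ℝ h) (hn : 3 ≤ n)
    (hbal : ∀ p, weightedMeanCurvatureVector n F h p + gradient h (F p) = 0) :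
    ∃ k, ∀ p, ‖F p‖ = k := by
  let φ : E → ℝ := fun y => -(1 + ‖y‖ ^ 2) ^ (-(1 / 2) : ℝ)
  let X : E → E := fun y => (1 + ‖y‖ ^ 2) ^ (-(3 / 2) : ℝ) • y
  have hpos : ∀ y : E, 0 < 1 + ‖y‖ ^ 2 := fun y => by positivity
  have hφ : ∀ y, HasGradientAt φ (X y) y := by
    intro y
    rw [hasGradientAt_iff_hasFDerivAt]
    refine (hasFDerivAt_one_add_norm_sq_rpow (-(1 / 2)) y).neg.congr_fderiv ?_
    ext v
    simp [X]
    norm_num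
  have hX : ∀ y, HasFDerivAt X ((1 + ‖y‖ ^ 2) ^ (-(3 / 2) : ℝ) • ContinuousLinearMap.id ℝ E +
      ((2 * (-(3 / 2)) * (1 + ‖y‖ ^ 2) ^ (-(3 / 2) - 1 : ℝ)) • innerSL ℝ y).smulRight y) y :=
    fun y => (hasFDerivAt_one_add_norm_sq_rpow (-(3 / 2)) y).smul (hasFDerivAt_id y)
  have hu : ContMDiff (𝓡 n) 𝓘(ℝ, ℝ) 2 fun q => φ (F q) := by
    have hφc : ContDiff ℝ ∞ φ := by
      refine ContDiff.neg ?_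
      exact ContDiff.rpow_const_of_ne (contDiff_const.add (contDiff_norm_sq ℝ)) fun y => (hpos y).ne'
    exact (hφc.contMDiff.comp hF.contMDiff).of_le (by norm_cast)
  obtain ⟨k, hk⟩ := hP _ hu ⟨0, by
    rintro _ ⟨p, rfl⟩
    exact neg_nonpos.mpr (Real.rpow_nonneg (hpos _).le _)⟩ fun p => by
    rw [weightedLaplacianP_comp_of_hasGradientAt hF hφ (hX _).differentiableAt (hh _), hbal,
      inner_zero_right, add_zero, (hX _).fderiv]
    set y := F p
    set b := stdOrthonormalBasis ℝ (tangentPlane n F p)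
    have hb : Orthonormal ℝ fun i => (b i : E) :=
      b.orthonormal.comp_linearIsometry (tangentPlane n F p).subtypeₗᵢ
    -- Bessel's inequality bounds the tangential part of `y`: the trace is `(1 + |y|²)^{-5/2} (n (1
    -- + |y|²) - 3 |y^T|²)`, which is nonnegative as soon as `n ≥ 3`.
    have hbessel : ∑ i, ⟪(b i : E), y⟫ ^ 2 ≤ ‖y‖ ^ 2 := by
      have := hb.sum_inner_products_le y (s := Finset.univ)
      simpa using this
    have hterm : ∀ i, ⟪((1 + ‖y‖ ^ 2) ^ (-(3 / 2) : ℝ) • ContinuousLinearMap.id ℝ E +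
        ((2 * (-(3 / 2)) * (1 + ‖y‖ ^ 2) ^ (-(3 / 2) - 1 : ℝ)) • innerSL ℝ y).smulRight y)
          (b i : E), (b i : E)⟫ = (1 + ‖y‖ ^ 2) ^ (-(3 / 2) - 1 : ℝ) *
          ((1 + ‖y‖ ^ 2) - 3 * ⟪(b i : E), y⟫ ^ 2) := by
      intro i
      have h1 : ⟪(b i : E), (b i : E)⟫ = 1 := by
        rw [real_inner_self_eq_norm_sq, hb.1 i, one_pow]
      have h2 : (1 + ‖y‖ ^ 2) ^ (-(3 / 2) : ℝ) =
          (1 + ‖y‖ ^ 2) ^ (-(3 / 2) - 1 : ℝ) * (1 + ‖y‖ ^ 2) := by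
        rw [← Real.rpow_add_one (hpos y).ne']
        norm_num
      simp only [add_apply, FunLike.coe_smul, Pi.smul_apply, ContinuousLinearMap.smulRight_apply,
        ContinuousLinearMap.id_apply, innerSL_apply_apply, inner_add_left, inner_smul_left,
        smul_eq_mul, h1, real_inner_comm y (b i : E), RCLike.conj_to_real]
      rw [h2]
      ring
    simp only [hterm]
    rw [← Finset.mul_sum, Finset.sum_sub_distrib, ← Finset.mul_sum, Finset.sum_const,
      Finset.card_univ, Fintype.card_fin, nsmul_eq_mul]
    refine mul_nonneg (Real.rpow_nonneg (hpos y).le _) ?_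
    have hn' : (3 : ℝ) ≤ Module.finrank ℝ (tangentPlane n F p) := by
      rw [finrank_tangentPlane hF]; exact_mod_cast hn
    nlinarith [mul_le_mul_of_nonneg_right hn' (hpos y).le]
  have hinj : ∀ p q, ‖F p‖ = ‖F q‖ := by
    intro p q
    have h1 : (1 + ‖F p‖ ^ 2) ^ (-(1 / 2) : ℝ) = (1 + ‖F q‖ ^ 2) ^ (-(1 / 2) : ℝ) :=
      neg_injective ((hk p).trans (hk q).symm)
    rw [Real.rpow_left_inj (hpos _).le (hpos _).le (by norm_num), add_right_inj] at h1
    exact (sq_eq_sq₀ (norm_nonneg _) (norm_nonneg _)).mp h1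
  rcases isEmpty_or_nonempty P with hE | ⟨⟨p₀⟩⟩
  · exact ⟨0, fun p => (hE.false p).elim⟩
  · exact ⟨‖F p₀‖, fun p => hinj p p₀⟩

/-- A complete hypersurface contained in a hyperplane coincides with it. -/
theorem coincidesWith_hyperplane [T2Space P] [ConnectedSpace P] [FiniteDimensional ℝ E]
    (hdim : Module.finrank ℝ E = n + 1) (hF : IsSmoothImmersion n F)
    (hcomplete : IsCompleteSubmanifold n F) {a : E} (ha : ‖a‖ = 1) {s : ℝ}
    (hs : ContainedIn F (hyperplane a s)) : CoincidesWith F (hyperplane a s) := by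
  have hs' : ∀ p, ⟪F p, a⟫ = s := hs
  have haa : ⟪a, a⟫ = 1 := by rw [real_inner_self_eq_norm_sq, ha, one_pow]
  have ha0 : a ≠ 0 := fun h0 => by simp [h0] at ha
  set W : Submodule ℝ E := (ℝ ∙ a)ᗮ with hW
  have hmemW : ∀ x : E, x ∈ W ↔ ⟪x, a⟫ = 0 := fun x =>
    Submodule.mem_orthogonal_singleton_iff_inner_left
  let π : E →L[ℝ] W := W.orthogonalProjectionOnto
  have hπ : ∀ x ∈ W, (π x : E) = x := fun x hx => Submodule.starProjection_eq_self_iff.mpr hx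
  -- `F` and its projection to `W` differ by the constant `s • a`, so they have the same
  -- differential and the projection is a local isometry into `W`.
  have hFG : ∀ p, F p = s • a + (π (F p) : E) := by
    intro p
    have h1 : F p - s • a ∈ W := by
      rw [hmemW, inner_sub_left, inner_smul_left, haa, hs']; simp
    have h2 : π (s • a) = 0 := by
      refine Submodule.orthogonalProjectionOnto_apply_of_mem_orthogonal ?_
      exact W.orthogonal.smul_mem s (Submodule.le_orthogonal_orthogonal _
        (Submodule.mem_span_singleton_self a))
    have h3 := hπ _ h1
    rw [map_sub, h2, sub_zero] at h3
    rw [h3]; abel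
  have hFd : ∀ p, MDifferentiableAt (𝓡 n) 𝓘(ℝ, E) F p := fun q =>
    (hF.contMDiff q).mdifferentiableAt (by simp)
  have htangent : ∀ p v, differential n F p v ∈ W := by
    intro p v
    rw [hmemW, real_inner_comm,
      ← differential_comp_of_hasGradientAt (hFd p) (hasGradientAt_inner_const a (F p)), funext hs']
    have : differential n (fun _ : P => s) p = 0 := mfderiv_const
    rw [this]; rfl
  have hGs : ContMDiff (𝓡 n) 𝓘(ℝ, W) ∞ (fun p => π (F p)) :=
    π.contDiff.contMDiff.comp hF.contMDiff
  have hGd : ∀ p v, (differential n (fun q => π (F q)) p v : E) = differential n F p v := by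
    intro p v
    have h1 := mfderiv_comp p π.differentiableAt.mdifferentiableAt (hFd p)
    rw [mfderiv_eq_fderiv, π.fderiv] at h1
    have h2 : differential n (fun q => π (F q)) p v = π (differential n F p v) :=
      congrArg (fun T : EuclideanSpace ℝ (Fin n) →L[ℝ] W => T v) h1
    rw [h2, hπ _ (htangent p v)]
  have hfin : Module.finrank ℝ (EuclideanSpace ℝ (Fin n)) = Module.finrank ℝ W := by
    have : Fact (Module.finrank ℝ E = n + 1) := ⟨hdim⟩
    rw [finrank_euclideanSpace_fin, hW, Submodule.finrank_orthogonal_span_singleton (n := n) ha0]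
  have hbij : ∀ p, Function.Bijective (differential n (fun q => π (F q)) p) := by
    intro p
    have hinj : Function.Injective (differential n (fun q => π (F q)) p) := fun v w hvw =>
      hF.injective_differential p (by rw [← hGd, ← hGd, hvw])
    exact ⟨hinj, (LinearMap.injective_iff_surjective_of_finrank_eq_finrank hfin
      (f := (differential n (fun q => π (F q)) p).toLinearMap)).mp hinj⟩
  have hGbij := bijective_of_isCompleteSubmanifold hF.contMDiff hcomplete hFG
    fun p => exists_isLocalInverseAt hGs (hbij p)
  refine ⟨fun p q hpq => hGbij.1 (by simp only [hpq]), Set.Subset.antisymm ?_ fun y hy => ?_⟩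
  · rintro _ ⟨p, rfl⟩
    exact hs p
  · have hy' : ⟪y, a⟫ = s := hy
    have h1 : y - s • a ∈ W := by
      rw [hmemW, inner_sub_left, inner_smul_left, haa, hy']; simp
    obtain ⟨p, hp⟩ := hGbij.2 ⟨y - s • a, h1⟩
    refine ⟨p, ?_⟩
    have hp' : π (F p) = ⟨y - s • a, h1⟩ := hp
    rw [hFG, hp']
    exact add_sub_cancel _ _

end Parabolic

/-! ### Half-space theorems for a vertical weight. -/

section VerticalWeight

variable {m n : ℕ} {μ : ℝ → ℝ}

theorem inner_verticalVector (y : Ambient m) : ⟪y, verticalVector m⟫ = height y := by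
  simp [verticalVector, height, WithLp.prod_inner_apply]

theorem norm_verticalVector : ‖verticalVector m‖ = 1 := by
  have h : ‖verticalVector m‖ ^ 2 = 1 := by
    rw [← real_inner_self_eq_norm_sq, inner_verticalVector]
    simp [verticalVector, height]
  exact (pow_eq_one_iff_of_nonneg (norm_nonneg _) two_ne_zero).mp h

theorem finrank_ambient (hm : 1 ≤ m) : Module.finrank ℝ (Ambient m) = m := by
  rw [(WithLp.linearEquiv 2 ℝ (EuclideanSpace ℝ (Fin (m - 1)) × ℝ)).finrank_eq,
    Module.finrank_prod, finrank_euclideanSpace_fin, Module.finrank_self]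
  omega

theorem hasGradientAt_verticalWeight {y : Ambient m} (hμ : DifferentiableAt ℝ μ (height y)) :
    HasGradientAt (verticalWeight m μ) (deriv μ (height y) • verticalVector m) y := by
  have h1 := hasGradientAt_inner_const (verticalVector m) y
  rw [hasGradientAt_iff_hasFDerivAt] at h1 ⊢
  simp only [inner_verticalVector] at h1
  refine (hμ.hasDerivAt.comp_hasFDerivAt y h1).congr_fderiv ?_
  rw [map_smulₛₗ]
  rfl

theorem differentiable_verticalWeight (hμ : Differentiable ℝ μ) :
    Differentiable ℝ (verticalWeight m μ) :=
  fun _ => (hasGradientAt_verticalWeight (hμ _)).differentiableAt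

theorem gradient_verticalWeight (hμ : Differentiable ℝ μ) (y : Ambient m) :
    gradient (verticalWeight m μ) y = deriv μ (height y) • verticalVector m :=
  (hasGradientAt_verticalWeight (hμ _)).gradient

variable {P : Type*} [TopologicalSpace P] [T2Space P] [ConnectedSpace P]
  [ChartedSpace (EuclideanSpace ℝ (Fin n)) P] [IsManifold (𝓡 n) ∞ P] {F : P → Ambient m}

/-- The half-space theorem for horizontal half-spaces; `ε = ±1` distinguishes lower half-spaces
from upper ones. -/
theorem horizontal_halfSpace (hm : 2 ≤ m) (hμ : Differentiable ℝ μ) (hF : IsSmoothImmersion n F)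
    (hP : IsWeightedParabolic n F (verticalWeight m μ)) {ε : ℝ} (hε : ε * ε = 1) {c : ℝ}
    (hc : ∀ s, c ≤ ε * deriv μ s)
    (hH : ∀ p, ‖weightedMeanCurvatureVector n F (verticalWeight m μ) p‖ ≤ c) {t₀ : ℝ}
    (ht₀ : ∀ p, ε * ⟪F p, verticalVector m⟫ ≤ t₀) :
    ∃ t, deriv μ t = ε * c ∧ ContainedIn F (hyperplane (verticalVector m) t) ∧
      (∀ p, weightedMeanCurvatureVector n F (verticalWeight m μ) p =
        -((ε * c) • verticalVector m)) ∧
      (n + 1 = m → IsCompleteSubmanifold n F →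
        CoincidesWith F (hyperplane (verticalVector m) t) ∧ (m = 2 ∨ m = 3)) := by
  set H := weightedMeanCurvatureVector n F (verticalWeight m μ) with hHdef
  have hv1 : ⟪verticalVector m, verticalVector m⟫ = 1 := by
    rw [real_inner_self_eq_norm_sq, norm_verticalVector, one_pow]
  have hform : ∀ p, ⟪ε • verticalVector m, H p + gradient (verticalWeight m μ) (F p)⟫ =
      ε * ⟪verticalVector m, H p⟫ + ε * deriv μ (height (F p)) := by
    intro p
    rw [gradient_verticalWeight hμ, inner_smul_left, inner_add_right, inner_smul_right, hv1]
    simp [mul_add]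
  have hεabs : |ε| = 1 := by
    rcases mul_self_eq_one_iff.mp hε with h | h <;> simp [h]
  have hcs : ∀ p, -c ≤ ε * ⟪verticalVector m, H p⟫ := by
    intro p
    have h1 : |ε * ⟪verticalVector m, H p⟫| ≤ c := by
      rw [abs_mul, hεabs, one_mul]
      refine (abs_real_inner_le_norm _ _).trans ?_
      rw [norm_verticalVector, one_mul]
      exact hH p
    exact (abs_le.mp h1).1
  obtain ⟨s, hs, hzero⟩ := hP.exists_inner_eq hF (differentiable_verticalWeight hμ)
    (b := ε • verticalVector m) (t₀ := t₀)
    (fun p => by rw [inner_smul_right]; exact ht₀ p)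
    (fun p => by rw [← hHdef, hform]; linarith [hcs p, hc (height (F p))])
  have hheight : ∀ p, height (F p) = ε * s := by
    intro p
    rw [← hs p, inner_smul_right, ← mul_assoc, hε, one_mul, inner_verticalVector]
  -- Two quantities bounded below by `c` and `-c` sum to zero, so both bounds are attained.
  have heq : ∀ p, ε * deriv μ (ε * s) = c ∧ ε * ⟪verticalVector m, H p⟫ = -c := by
    intro p
    have h1 := hzero p
    rw [← hHdef, hform, hheight] at h1
    have h2 := hcs p
    have h3 := hc (ε * s)
    constructor <;> linarith
  obtain ⟨p₀⟩ : Nonempty P := inferInstance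
  have hderiv : deriv μ (ε * s) = ε * c := by
    rw [← (heq p₀).1, ← mul_assoc, hε, one_mul]
  have hHeq : ∀ p, H p = -((ε * c) • verticalVector m) := by
    intro p
    have h1 : ⟪H p, verticalVector m⟫ = -(ε * c) := by
      rw [real_inner_comm]
      linear_combination ε * (heq p).2 - ⟪verticalVector m, H p⟫ * hε
    -- Equality in Cauchy–Schwarz: expanding the square gives `‖H‖² - 2c² + c²`, at most zero since
    -- `‖H‖ ≤ c`.
    have h2 : ‖H p + (ε * c) • verticalVector m‖ ^ 2 ≤ 0 := by
      rw [norm_add_sq_real, inner_smul_right, h1, norm_smul, norm_verticalVector, mul_one,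
        Real.norm_eq_abs, sq_abs]
      have h3 : ‖H p‖ ^ 2 ≤ c ^ 2 := pow_le_pow_left₀ (norm_nonneg _) (hH p) 2
      have h4 : (ε * c) ^ 2 = c ^ 2 := by linear_combination c ^ 2 * hε
      linarith
    have h5 : ‖H p + (ε * c) • verticalVector m‖ = 0 :=
      pow_eq_zero_iff (two_ne_zero) |>.mp (le_antisymm h2 (sq_nonneg _))
    exact eq_neg_of_add_eq_zero_left (norm_eq_zero.mp h5)
  have hcont : ContainedIn F (hyperplane (verticalVector m) (ε * s)) := fun p =>
    (inner_verticalVector _).trans (hheight p)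
  refine ⟨ε * s, hderiv, hcont, hHeq, fun hnm hcomplete => ?_⟩
  have hcoin := coincidesWith_hyperplane (by rw [finrank_ambient (by omega), hnm]) hF hcomplete
    norm_verticalVector hcont
  refine ⟨hcoin, ?_⟩
  by_contra hm3
  obtain ⟨k, hk⟩ := hP.exists_norm_eq hF (differentiable_verticalWeight hμ) (by omega)
    fun p => by
      rw [gradient_verticalWeight hμ, hheight, hderiv, ← hHdef, hHeq, neg_add_cancel]
  -- A horizontal unit direction. The hyperplane contains the whole line along it, on which the norm
  -- is not constant.
  let e : EuclideanSpace ℝ (Fin (m - 1)) := EuclideanSpace.single ⟨0, by omega⟩ 1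
  have hpoint : ∀ r : ℝ, ∃ p, F p = WithLp.toLp 2 (r • e, ε * s) := by
    intro r
    have : WithLp.toLp 2 (r • e, ε * s) ∈ hyperplane (verticalVector m) (ε * s) :=
      inner_verticalVector _
    rwa [← hcoin.2] at this
  have hnorm : ∀ r : ℝ, r ^ 2 + (ε * s) ^ 2 = k ^ 2 := by
    intro r
    obtain ⟨p, hp⟩ := hpoint r
    rw [← hk p, hp, WithLp.prod_norm_sq_eq_of_L2]
    simp [e, norm_smul, ← abs_mul]
  have h0 := hnorm 0
  have h1 := hnorm 1
  linarith

/-- The half-space theorem for `h`-minimal submanifolds; `ε = ±1` distinguishes lower half-spaces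
from upper ones. -/
theorem minimal_halfSpace (hm : 2 ≤ m) (hμ : Differentiable ℝ μ) (hF : IsSmoothImmersion n F)
    (hP : IsWeightedParabolic n F (verticalWeight m μ)) {ε : ℝ} (hε : ε * ε = 1) {a : Ambient m}
    (ha : ‖a‖ = 1) (hmin : IsWeightedMinimal n F (verticalWeight m μ))
    (hsub : ∀ s, 0 ≤ ε * (deriv μ s * ⟪a, verticalVector m⟫)) {t₀ : ℝ}
    (ht₀ : ∀ p, ε * ⟪F p, a⟫ ≤ t₀) :
    ∃ t, ContainedIn F (hyperplane a t) ∧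
      (∀ p, deriv μ (height (F p)) * ⟪a, verticalVector m⟫ = 0) ∧
      (n + 1 = m → IsCompleteSubmanifold n F → CoincidesWith F (hyperplane a t)) := by
  have hform : ∀ p, ⟪ε • a, weightedMeanCurvatureVector n F (verticalWeight m μ) p +
      gradient (verticalWeight m μ) (F p)⟫ =
      ε * (deriv μ (height (F p)) * ⟪a, verticalVector m⟫) := by
    intro p
    rw [hmin p, zero_add, gradient_verticalWeight hμ, inner_smul_left, inner_smul_right]
    rfl
  obtain ⟨s, hs, hzero⟩ := hP.exists_inner_eq hF (differentiable_verticalWeight hμ)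
    (b := ε • a) (t₀ := t₀) (fun p => by rw [inner_smul_right]; exact ht₀ p)
    (fun p => by rw [hform]; exact hsub _)
  have hε0 : ε ≠ 0 := left_ne_zero_of_mul_eq_one hε
  have hcont : ContainedIn F (hyperplane a (ε * s)) := fun p => by
    change ⟪F p, a⟫ = ε * s
    rw [← hs p, inner_smul_right, ← mul_assoc, hε, one_mul]
  refine ⟨ε * s, hcont, fun p => ?_, fun hnm hcomplete => ?_⟩
  -- The product with `⟪a, ∂_t⟫` is kept because this factor may be zero; dividing by it is left to
  -- the case where it is positive.
  · have h1 := hzero p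
    rw [hform] at h1
    exact (mul_eq_zero.mp h1).resolve_left hε0
  · exact coincidesWith_hyperplane (by rw [finrank_ambient (by omega), hnm]) hF hcomplete ha hcont

/-- A hyperplane which is not horizontal contains points of every height. -/
theorem exists_mem_hyperplane_height_eq {a : Ambient m} (ha : ‖a‖ = 1)
    (hlt : ⟪a, verticalVector m⟫ ^ 2 < 1) (t s : ℝ) : ∃ y ∈ hyperplane a t, height y = s := by
  set α := ⟪a, verticalVector m⟫ with hα
  have haa : ⟪a, a⟫ = 1 := by rw [real_inner_self_eq_norm_sq, ha, one_pow]
  have hvv : ⟪verticalVector m, verticalVector m⟫ = 1 := by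
    rw [real_inner_self_eq_norm_sq, norm_verticalVector, one_pow]
  have hva : ⟪verticalVector m, a⟫ = α := by rw [real_inner_comm]
  have hne : 1 - α ^ 2 ≠ 0 := (sub_pos.mpr hlt).ne'
  -- The component of `∂_t` orthogonal to `a` has height `1 - α²`. Moving along it stays in the
  -- hyperplane and corrects the height `t * α` of `t • a` to `s`.
  refine ⟨t • a + ((s - t * α) / (1 - α ^ 2)) • (verticalVector m - α • a), ?_, ?_⟩
  · change ⟪_, a⟫ = t
    simp only [inner_add_left, inner_sub_left, real_inner_smul_left, haa, hva]
    ring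
  · rw [← inner_verticalVector]
    simp only [inner_add_left, inner_sub_left, real_inner_smul_left, hvv, ← hα]
    field_simp
    ring

end VerticalWeight
end ImmersedSubmanifold

theorem theorem4p11 {m n : ℕ} (hm : 2 ≤ m) (hnm : n < m)
    (μ : ℝ → ℝ) (hμ : ContDiff ℝ 1 μ)
    {P : Type*} [TopologicalSpace P] [T2Space P] [SecondCountableTopology P] [ConnectedSpace P]
    [ChartedSpace (EuclideanSpace ℝ (Fin n)) P] [IsManifold (𝓡 n) ∞ P]
    (F : P → Ambient m) (hF : IsSmoothImmersion n F)
    (hP : IsWeightedParabolic n F (verticalWeight m μ)) :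
    -- (i), first version
    (∀ c : ℝ, 0 ≤ c → (∀ s, c ≤ deriv μ s) →
      (∀ p, ‖weightedMeanCurvatureVector n F (verticalWeight m μ) p‖ ≤ c) →
      (∃ t₀, ContainedIn F (lowerHalfSpace (verticalVector m) t₀)) →
      ∃ t, deriv μ t = c ∧ ContainedIn F (hyperplane (verticalVector m) t) ∧
        (∀ p, weightedMeanCurvatureVector n F (verticalWeight m μ) p = -(c • verticalVector m)) ∧
        (n + 1 = m → IsCompleteSubmanifold n F →
          CoincidesWith F (hyperplane (verticalVector m) t) ∧ (m = 2 ∨ m = 3))) ∧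
    -- (i), second version
    (∀ c : ℝ, 0 ≤ c → (∀ s, deriv μ s ≤ -c) →
      (∀ p, ‖weightedMeanCurvatureVector n F (verticalWeight m μ) p‖ ≤ c) →
      (∃ t₀, ContainedIn F (upperHalfSpace (verticalVector m) t₀)) →
      ∃ t, deriv μ t = -c ∧ ContainedIn F (hyperplane (verticalVector m) t) ∧
        (∀ p, weightedMeanCurvatureVector n F (verticalWeight m μ) p = c • verticalVector m) ∧
        (n + 1 = m → IsCompleteSubmanifold n F →
          CoincidesWith F (hyperplane (verticalVector m) t) ∧ (m = 2 ∨ m = 3))) ∧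
    -- (ii), both versions
    (∀ a : Ambient m, ‖a‖ = 1 → ⟪a, verticalVector m⟫ ∈ Set.Ioo (0 : ℝ) 1 →
      IsWeightedMinimal n F (verticalWeight m μ) →
      (((∀ s, 0 ≤ deriv μ s) ∧ ∃ t₀, ContainedIn F (lowerHalfSpace a t₀)) ∨
        ((∀ s, deriv μ s ≤ 0) ∧ ∃ t₀, ContainedIn F (upperHalfSpace a t₀))) →
      ∃ t, ContainedIn F (hyperplane a t) ∧
        (∃ k, ∀ p, μ (height (F p)) = k) ∧
        (n + 1 = m → IsCompleteSubmanifold n F →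
          CoincidesWith F (hyperplane a t) ∧ ∃ k, ∀ s, μ s = k)) ∧
    -- (iii)
    (∀ a : Ambient m, ‖a‖ = 1 → ⟪a, verticalVector m⟫ = 0 →
      IsWeightedMinimal n F (verticalWeight m μ) →
      ((∃ t₀, ContainedIn F (lowerHalfSpace a t₀)) ∨
        (∃ t₀, ContainedIn F (upperHalfSpace a t₀))) →
      ∃ t, ContainedIn F (hyperplane a t) ∧
        (n + 1 = m → IsCompleteSubmanifold n F → CoincidesWith F (hyperplane a t))) := by
  have hμd : Differentiable ℝ μ := hμ.differentiable one_ne_zero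
  have hlower : ∀ {a : Ambient m} {t₀ : ℝ}, ContainedIn F (lowerHalfSpace a t₀) →
      ∀ p, 1 * ⟪F p, a⟫ ≤ t₀ := fun h p => by rw [one_mul]; exact h p
  have hupper : ∀ {a : Ambient m} {t₀ : ℝ}, ContainedIn F (upperHalfSpace a t₀) →
      ∀ p, -1 * ⟪F p, a⟫ ≤ -t₀ := fun {a t₀} h p => by
    have h1 : t₀ ≤ ⟪F p, a⟫ := h p
    linarith
  refine ⟨?_, ?_, ?_, ?_⟩
  · rintro c - hc hH ⟨t₀, ht₀⟩
    simpa only [one_mul] using horizontal_halfSpace hm hμd hF hP (one_mul (1 : ℝ))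
      (fun s => by rw [one_mul]; exact hc s) hH (hlower ht₀)
  · rintro c - hc hH ⟨t₀, ht₀⟩
    simpa only [neg_one_mul, neg_smul, neg_neg] using horizontal_halfSpace hm hμd hF hP
      (show (-1 : ℝ) * -1 = 1 by norm_num) (fun s => by linarith [hc s]) hH (hupper ht₀)
  · intro a ha hα hmin hcases
    have hmain : ∃ t, ContainedIn F (hyperplane a t) ∧
        (∀ p, deriv μ (height (F p)) * ⟪a, verticalVector m⟫ = 0) ∧
        (n + 1 = m → IsCompleteSubmanifold n F → CoincidesWith F (hyperplane a t)) := by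
      rcases hcases with ⟨hd, t₀, ht₀⟩ | ⟨hd, t₀, ht₀⟩
      · exact minimal_halfSpace hm hμd hF hP (one_mul (1 : ℝ)) ha hmin
          (fun s => by rw [one_mul]; exact mul_nonneg (hd s) hα.1.le) (hlower ht₀)
      · exact minimal_halfSpace hm hμd hF hP (show (-1 : ℝ) * -1 = 1 by norm_num) ha hmin
          (fun s => by linarith [mul_nonneg (neg_nonneg.mpr (hd s)) hα.1.le]) (hupper ht₀)
    obtain ⟨t, ht, hzero, hcoin⟩ := hmain
    -- As `⟪a, ∂_t⟫ > 0`, `μ'` vanishes at every height of `P`, so the ambient gradient of the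
    -- weight is zero along the image.
    obtain ⟨k, hk⟩ := exists_comp_eq_of_hasFDerivAt_zero hF (φ := verticalWeight m μ) fun p => by
      have h1 := (hasGradientAt_verticalWeight (m := m) (y := F p) (hμd _)).hasFDerivAt
      rwa [(mul_eq_zero.mp (hzero p)).resolve_right hα.1.ne', zero_smul, map_zero] at h1
    refine ⟨t, ht, ⟨k, hk⟩, fun hn hcomplete => ⟨hcoin hn hcomplete, k, fun s => ?_⟩⟩
    -- `⟪a, ∂_t⟫ < 1` means that the hyperplane is not horizontal, so every `s` is the height of a
    -- point of `P`.
    obtain ⟨y, hy, rfl⟩ := exists_mem_hyperplane_height_eq ha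
      (by nlinarith [hα.1, hα.2]) t s
    rw [← (hcoin hn hcomplete).2] at hy
    obtain ⟨p, rfl⟩ := hy
    exact hk p
  · intro a ha hα hmin hcases
    rcases hcases with ⟨t₀, ht₀⟩ | ⟨t₀, ht₀⟩
    · obtain ⟨t, ht, -, hcoin⟩ := minimal_halfSpace hm hμd hF hP (one_mul (1 : ℝ)) ha hmin
        (fun s => by simp [hα]) (hlower ht₀)
      exact ⟨t, ht, hcoin⟩
    · obtain ⟨t, ht, -, hcoin⟩ := minimal_halfSpace hm hμd hF hP
        (show (-1 : ℝ) * -1 = 1 by norm_num) ha hmin (fun s => by simp [hα]) (hupper ht₀)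
      exact ⟨t, ht, hcoin⟩
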